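/- **Theorem (Existence of connections on a principaloid bundle).** All manifolds are smooth, finite-dimensional and without boundary; the base $\Sigma$ is Hausdorff and second countable. Let $\mathscr{G}\rightrightarrows M$ be a Lie groupoid with source map $s$ and target map $t$ (surjective submersions), the product $g.h$ being defined when $s(g)=t(h)$. Then on every principaloid $\mathscr{G}$-bundle there exists a compatible connection. Here a *principaloid $\mathscr{G}$-bundle* is given in either of the following two (equivalent) ways, and the assertion holds for both. 1. A fibre bundle $\pi\colon\mathscr{P}\to\Sigma$ with typical fibre the arrow manifold $\mathscr{G}$, whose total space carries a right $\mathscr{G}$-module structure, i.e. a smooth moment map $\mu\colon\mathscr{P}\to M$ and a smooth action $\varrho\colon\{(p,g)\in\mathscr{P}\times\mathscr{G} : \mu(p)=t(g)\}\to\mathscr{P}$, $(p,g)\mapsto\varrho_g(p)$, with $\mu(\varrho_g(p))=s(g)$, $\varrho_{\mathrm{Id}_{\mu(p)}}(p)=p$ and $\varrho_h(\varrho_g(p))=\varrho_{g.h}(p)$ whenever defined, such that $\varrho$ preserves the fibres of $\pi$, and such that $\Sigma$ is covered by open sets $O$ with smooth local trivialisations $\tau\colon\pi^{-1}(O)\to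 O\times\mathscr{G}$ satisfying $\mu(\tau^{-1}(\sigma,g))=s(g)$ and $\varrho_h(\tau^{-1}(\sigma,g))=\tau^{-1}(\sigma,g.h)$ for $s(g)=t(h)$. 2. A fibre bundle $\pi\colon\mathscr{P}\to\Sigma$ with typical fibre $\mathscr{G}$ and an atlas of smooth local trivialisations $\tau_i\colon\pi^{-1}(O_i)\to O_i\times\mathscr{G}$ whose transition maps are $\tau_i\circ\tau_j^{-1}(\sigma,g)=(\sigma,\ \beta_{ij}(\sigma)(t(g)).g)$, where each $\beta_{ij}(\sigma)\colon M\to\mathscr{G}$ is a bisection (a smooth section of $s$ such that $t\circ\beta_{ij}(\sigma)$ is a diffeomorphism of $M$) and $(\sigma,m)\mapsto\beta_{ij}(\sigma)(m)$ is smooth on $(O_i\cap O_j)\times M$. In this case $\mu$ and $\varrho$ are the well-defined maps given by $\mu(\tau_i^{-1}(\sigma,g))=s(g)$ and $\varrho_h(\tau_i^{-1}(\sigma,g))=\tau_i^{-1}(\sigma,g.h)$. A *compatible connection* on $\mathscr{P}$ is a smooth distribution $\mathrm{H}\mathscr{P}\subset\mathrm{T}\mathscr{P}$ such that $\mathrm{T}\mathscr{P}=\ker\mathrm{T}\pi\oplus\mathrm{H}\mathscr{P}$,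 $\mathrm{H}\mathscr{P}\subset\ker\mathrm{T}\mu$, and $\mathrm{T}\varrho_g(\mathrm{H}_p\mathscr{P})=\mathrm{H}_{\varrho_g(p)}\mathscr{P}$ for all $g\in\mathscr{G}$ and $p\in\mu^{-1}(\{t(g)\})$, where $\varrho_g$ is regarded as a map on the submanifold $\mu^{-1}(\{t(g)\})$, whose tangent spaces are $\ker\mathrm{T}_p\mu$. -/

import Mathlib

open Set Topology Manifold
open scoped ContDiff

section LieGroupoids

variable {EM EG ES EP : Type*}
  [NormedAddCommGroup EM] [NormedSpace ℝ EM] [NormedAddCommGroup EG] [NormedSpace ℝ EG]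
  [NormedAddCommGroup ES] [NormedSpace ℝ ES] [NormedAddCommGroup EP] [NormedSpace ℝ EP]
  {M G S P : Type*}
  [TopologicalSpace M] [ChartedSpace EM M] [TopologicalSpace G] [ChartedSpace EG G]
  [TopologicalSpace S] [ChartedSpace ES S] [TopologicalSpace P] [ChartedSpace EP P]

variable (EM EG M G) in
/-- A Lie groupoid with object manifold `M` and arrow manifold `G`. The product `mul g h` is the
arrow `g.h` when `s g = t h`; its values on the other pairs are never used. Since `s` and `t` are
submersions, the set of composable pairs is an embedded submanifold of `G × G`, and smoothness of a
map on that submanifold is the same as `ContMDiffOn` on the set. -/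
structure LieGroupoid where
  /-- source map -/
  s : G → M
  /-- target map -/
  t : G → M
  /-- unit map -/
  unit : M → G
  /-- inverse map -/
  inv : G → G
  /-- multiplication of composable arrows -/
  mul : G → G → G
  s_unit : ∀ m, s (unit m) = m
  t_unit : ∀ m, t (unit m) = m
  s_mul : ∀ g h, s g = t h → s (mul g h) = s h
  t_mul : ∀ g h, s g = t h → t (mul g h) = t g
  mul_assoc : ∀ g h k, s g = t h → s h = t k → mul (mul g h) k = mul g (mul h k)
  unit_mul : ∀ g, mul (unit (t g)) g = g
  mul_unit : ∀ g, mul g (unit (s g)) = g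
  s_inv : ∀ g, s (inv g) = t g
  t_inv : ∀ g, t (inv g) = s g
  mul_inv : ∀ g, mul g (inv g) = unit (t g)
  inv_mul : ∀ g, mul (inv g) g = unit (s g)
  s_surjective : Function.Surjective s
  t_surjective : Function.Surjective t
  s_submersion : IsSubmersion 𝓘(ℝ, EG) 𝓘(ℝ, EM) ∞ s
  t_submersion : IsSubmersion 𝓘(ℝ, EG) 𝓘(ℝ, EM) ∞ t
  unit_smooth : ContMDiff 𝓘(ℝ, EM) 𝓘(ℝ, EG) ∞ unit
  inv_smooth : ContMDiff 𝓘(ℝ, EG) 𝓘(ℝ, EG) ∞ inv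
  mul_smooth : ContMDiffOn (𝓘(ℝ, EG).prod 𝓘(ℝ, EG)) 𝓘(ℝ, EG) ∞
    (fun q : G × G => mul q.1 q.2) {q | s q.1 = t q.2}

/-- A (global) bisection: a smooth section `β` of the source map such that `t ∘ β` is a
diffeomorphism of `M`. -/
structure LieGroupoid.IsBisection (𝒢 : LieGroupoid EM EG M G) (β : M → G) : Prop where
  smooth : ContMDiff 𝓘(ℝ, EM) 𝓘(ℝ, EG) ∞ β
  s_apply : ∀ m, 𝒢.s (β m) = m
  t_diffeo : ∃ φ : M ≃ₘ^∞⟮𝓘(ℝ, EM), 𝓘(ℝ, EM)⟯ M, ∀ m, φ m = 𝒢.t (β m)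

/-- Left multiplication `L_β g = β (t g) . g` of arrows by a bisection. -/
def LieGroupoid.leftMul (𝒢 : LieGroupoid EM EG M G) (β : M → G) (g : G) : G :=
  𝒢.mul (β (𝒢.t g)) g

variable (EP) in
/-- The structure of a right `𝒢`-module on the manifold `P`: a smooth moment map `μ : P → M`
and a smooth action `P ×_{μ,t} G → P`. The value `act p g` matters only if `μ p = t g`. -/
structure IsRightModule (𝒢 : LieGroupoid EM EG M G) (μ : P → M) (act : P → G → P) : Prop where
  moment_smooth : ContMDiff 𝓘(ℝ, EP) 𝓘(ℝ, EM) ∞ μ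
  act_smooth : ContMDiffOn (𝓘(ℝ, EP).prod 𝓘(ℝ, EG)) 𝓘(ℝ, EP) ∞
    (fun q : P × G => act q.1 q.2) {q | μ q.1 = 𝒢.t q.2}
  moment_act : ∀ p g, μ p = 𝒢.t g → μ (act p g) = 𝒢.s g
  act_unit : ∀ p, act p (𝒢.unit (μ p)) = p
  act_act : ∀ p g h, μ p = 𝒢.t g → 𝒢.s g = 𝒢.t h → act (act p g) h = act p (𝒢.mul g h)

variable (EG ES EP) in
/-- A local trivialisation `π⁻¹(O) → O × G` that is a diffeomorphism. -/
structure IsSmoothTrivialization {π : P → S} (e : Bundle.Trivialization G π) : Prop where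
  smooth : ContMDiffOn 𝓘(ℝ, EP) (𝓘(ℝ, ES).prod 𝓘(ℝ, EG)) ∞ e e.source
  symm_smooth : ContMDiffOn (𝓘(ℝ, ES).prod 𝓘(ℝ, EG)) 𝓘(ℝ, EP) ∞
    e.toOpenPartialHomeomorph.symm e.target

variable (ES EP S P) in
/-- A principaloid `𝒢`-bundle over `S`: a fibre bundle `π : P → S` with typical fibre `G`, with a
right `𝒢`-module structure on `P` that preserves the fibres of `π`, and with local
trivialisations around all points of `S` that intertwine it with the right multiplication of `𝒢`
on `G` (whose moment map is `s`). -/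
structure PrincipaloidGBundle (𝒢 : LieGroupoid EM EG M G) where
  /-- bundle projection -/
  π : P → S
  /-- moment map -/
  μ : P → M
  /-- right action -/
  act : P → G → P
  π_surjective : Function.Surjective π
  π_submersion : IsSubmersion 𝓘(ℝ, EP) 𝓘(ℝ, ES) ∞ π
  isRightModule : IsRightModule EP 𝒢 μ act
  π_act : ∀ p g, μ p = 𝒢.t g → π (act p g) = π p
  exists_trivialization : ∀ b : S, ∃ e : Bundle.Trivialization G π,
    b ∈ e.baseSet ∧ IsSmoothTrivialization EG ES EP e ∧
    ∀ c ∈ e.baseSet, ∀ g,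
      μ (e.toOpenPartialHomeomorph.symm (c, g)) = 𝒢.s g ∧
      ∀ h, 𝒢.s g = 𝒢.t h →
        act (e.toOpenPartialHomeomorph.symm (c, g)) h =
          e.toOpenPartialHomeomorph.symm (c, 𝒢.mul g h)

variable (ES EP S P) in
/-- A fibre bundle `π : P → S` with typical fibre `G` together with a reduction of its structure
group to the group of left multiplications by bisections: a trivialising atlas whose transition
maps are `(c, g) ↦ (c, L_{β c} g)` for smooth bisection-valued maps `β` on the overlaps, smoothness
of `β` meaning that `(c, m) ↦ β c m` is smooth. -/
structure PrincipaloidBundle (𝒢 : LieGroupoid EM EG M G) where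
  /-- bundle projection -/
  π : P → S
  π_surjective : Function.Surjective π
  π_submersion : IsSubmersion 𝓘(ℝ, EP) 𝓘(ℝ, ES) ∞ π
  /-- the trivialising atlas that fixes the reduction -/
  atlas : Set (Bundle.Trivialization G π)
  atlas_smooth : ∀ e ∈ atlas, IsSmoothTrivialization EG ES EP e
  atlas_cover : ∀ b : S, ∃ e ∈ atlas, b ∈ e.baseSet
  transition : ∀ e ∈ atlas, ∀ e' ∈ atlas, ∃ β : S → M → G,
    (∀ c ∈ e.baseSet ∩ e'.baseSet, 𝒢.IsBisection (β c)) ∧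
    ContMDiffOn (𝓘(ℝ, ES).prod 𝓘(ℝ, EM)) 𝓘(ℝ, EG) ∞ (fun q : S × M => β q.1 q.2)
      ((e.baseSet ∩ e'.baseSet) ×ˢ univ) ∧
    ∀ c ∈ e.baseSet ∩ e'.baseSet, ∀ g,
      e (e'.toOpenPartialHomeomorph.symm (c, g)) = (c, 𝒢.leftMul (β c) g)

namespace PrincipaloidBundle

variable {𝒢 : LieGroupoid EM EG M G} (X : PrincipaloidBundle ES EP S P 𝒢)

/-- A trivialisation from the atlas around a given point of the base. -/
noncomputable def trivAt (b : S) : Bundle.Trivialization G X.π :=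
  Classical.choose (X.atlas_cover b)

/-- The canonical moment map: `τ⁻¹(c, g) ↦ s g` in each trivialisation `τ` of the atlas. -/
noncomputable def μ (p : P) : M := 𝒢.s (X.trivAt (X.π p) p).2

/-- The canonical right action: `(τ⁻¹(c, g), h) ↦ τ⁻¹(c, g.h)` in each trivialisation `τ` of the
atlas, for `s g = t h`. -/
noncomputable def act (p : P) (h : G) : P :=
  (X.trivAt (X.π p)).toOpenPartialHomeomorph.symm
    (X.π p, 𝒢.mul (X.trivAt (X.π p) p).2 h)

theorem trivAt_mem (b : S) : X.trivAt b ∈ X.atlas := (Classical.choose_spec (X.atlas_cover b)).1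

theorem mem_trivAt (b : S) : b ∈ (X.trivAt b).baseSet :=
  (Classical.choose_spec (X.atlas_cover b)).2

/-- The moment map has the stated form in every trivialisation of the atlas. -/
theorem μ_symm {e : Bundle.Trivialization G X.π} (he : e ∈ X.atlas) {c : S} (hc : c ∈ e.baseSet)
    (g : G) : X.μ (e.toOpenPartialHomeomorph.symm (c, g)) = 𝒢.s g := by
  obtain ⟨β, hβ, -, hT⟩ := X.transition _ (X.trivAt_mem c) e he
  have hc' := X.mem_trivAt c
  have hπ : X.π (e.toOpenPartialHomeomorph.symm (c, g)) = c := e.proj_symm_apply' hc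
  rw [μ, hπ, hT c ⟨hc', hc⟩ g]
  exact 𝒢.s_mul _ _ ((hβ c ⟨hc', hc⟩).s_apply _)

/-- The action has the stated form in every trivialisation of the atlas. -/
theorem act_symm {e : Bundle.Trivialization G X.π} (he : e ∈ X.atlas) {c : S} (hc : c ∈ e.baseSet)
    (g h : G) (hgh : 𝒢.s g = 𝒢.t h) :
    X.act (e.toOpenPartialHomeomorph.symm (c, g)) h =
      e.toOpenPartialHomeomorph.symm (c, 𝒢.mul g h) := by
  obtain ⟨β, hβ, -, hT⟩ := X.transition _ (X.trivAt_mem c) e he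
  have hc' := X.mem_trivAt c
  have hπ (k : G) : X.π (e.toOpenPartialHomeomorph.symm (c, k)) = c := e.proj_symm_apply' hc
  have hk := hT c ⟨hc', hc⟩ (𝒢.mul g h)
  have hsrc : e.toOpenPartialHomeomorph.symm (c, 𝒢.mul g h) ∈ (X.trivAt c).source := by
    rw [Bundle.Trivialization.mem_source, hπ]; exact hc'
  rw [act, hπ, hT c ⟨hc', hc⟩ g]
  have hmul : 𝒢.mul (𝒢.leftMul (β c) g) h = 𝒢.leftMul (β c) (𝒢.mul g h) := by
    rw [LieGroupoid.leftMul, LieGroupoid.leftMul, 𝒢.t_mul _ _ hgh]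
    exact 𝒢.mul_assoc _ _ _ ((hβ c ⟨hc', hc⟩).s_apply _) hgh
  rw [hmul, ← hk]
  exact (X.trivAt c).toOpenPartialHomeomorph.left_inv hsrc

end PrincipaloidBundle

/-- `H` is a smooth distribution (vector subbundle of the tangent bundle): near every point it is
spanned by finitely many smooth, pointwise linearly independent vector fields. -/
def IsSmoothDistribution [IsManifold 𝓘(ℝ, EP) ∞ P]
    (H : ∀ p : P, Submodule ℝ (TangentSpace 𝓘(ℝ, EP) p)) : Prop :=
  ∀ p₀ : P, ∃ U ∈ 𝓝 p₀, ∃ (k : ℕ) (Y : Fin k → ∀ p : P, TangentSpace 𝓘(ℝ, EP) p),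
    (∀ i, ContMDiffOn 𝓘(ℝ, EP) 𝓘(ℝ, EP).tangent ∞
      (fun p => (⟨p, Y i p⟩ : TangentBundle 𝓘(ℝ, EP) P)) U) ∧
    ∀ p ∈ U, LinearIndependent ℝ (fun i => Y i p) ∧
      Submodule.span ℝ (range fun i => Y i p) = H p

/-- `H` is a compatible connection on `π : P → S`, with respect to the right action `act` of `𝒢`
with moment map `μ`: a smooth distribution complementary to the vertical bundle `ker Tπ`, contained
in `ker Tμ`, and `𝒢`-invariant, `Tϱ_g (H_p) = H_{p.g}` for all composable `p` and `g`. Here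
`ϱ_g = act · g` is a map on the submanifold `μ⁻¹(t g)` of `P`, whose tangent space at `p` is
`ker T_p μ ⊇ H_p`; its tangent map is represented by a derivative `L` of `act · g` at `p` within
`μ⁻¹(t g)`, and the restriction of `L` to `ker T_p μ` does not depend on the choice of `L`. -/
structure IsCompatibleConnection [IsManifold 𝓘(ℝ, EP) ∞ P] (𝒢 : LieGroupoid EM EG M G)
    (π : P → S) (μ : P → M) (act : P → G → P)
    (H : ∀ p : P, Submodule ℝ (TangentSpace 𝓘(ℝ, EP) p)) : Prop where
  smooth : IsSmoothDistribution H
  isCompl : ∀ p, IsCompl (mfderiv 𝓘(ℝ, EP) 𝓘(ℝ, ES) π p).ker (H p)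
  le_ker : ∀ p, H p ≤ (mfderiv 𝓘(ℝ, EP) 𝓘(ℝ, EM) μ p).ker
  invariant : ∀ g p, μ p = 𝒢.t g →
    ∃ L : TangentSpace 𝓘(ℝ, EP) p →L[ℝ] TangentSpace 𝓘(ℝ, EP) (act p g),
      HasMFDerivWithinAt 𝓘(ℝ, EP) 𝓘(ℝ, EP) (fun q => act q g) (μ ⁻¹' {𝒢.t g}) p L ∧
      (H p).map L.toLinearMap = H (act p g)

end LieGroupoids

section AdaptedTrivializations

open Bundle

variable {EM EG ES EP : Type*}
  [NormedAddCommGroup EM] [NormedSpace ℝ EM] [NormedAddCommGroup EG] [NormedSpace ℝ EG]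
  [NormedAddCommGroup ES] [NormedSpace ℝ ES] [NormedAddCommGroup EP] [NormedSpace ℝ EP]
  {M G S P : Type*}
  [TopologicalSpace M] [ChartedSpace EM M] [TopologicalSpace G] [ChartedSpace EG G]
  [TopologicalSpace S] [ChartedSpace ES S] [TopologicalSpace P] [ChartedSpace EP P]
  {pr : P → S}

variable (ES EP) in
/-- A smooth local trivialisation that intertwines a map `act` with moment map `μ` with the right
multiplication of `𝒢`. -/
structure LieGroupoid.IsAdapted (𝒢 : LieGroupoid EM EG M G) (μ : P → M) (act : P → G → P)
    (e : Trivialization G pr) : Prop where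
  smooth : IsSmoothTrivialization EG ES EP e
  moment_symm : ∀ c ∈ e.baseSet, ∀ g, μ (e.toOpenPartialHomeomorph.symm (c, g)) = 𝒢.s g
  act_symm : ∀ c ∈ e.baseSet, ∀ g h, 𝒢.s g = 𝒢.t h →
    act (e.toOpenPartialHomeomorph.symm (c, g)) h =
      e.toOpenPartialHomeomorph.symm (c, 𝒢.mul g h)

/-- The section of `pr` through `p` that is constant in the trivialisation `e`. -/
def flatSection (e : Trivialization G pr) (p : P) (c : S) : P :=
  e.toOpenPartialHomeomorph.symm (c, (e p).2)

theorem proj_flatSection (e : Trivialization G pr) (p : P) {c : S} (hc : c ∈ e.baseSet) :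
    pr (flatSection e p c) = c :=
  e.proj_symm_apply' hc

theorem flatSection_self (e : Trivialization G pr) {p : P} (hp : pr p ∈ e.baseSet) :
    flatSection e p (pr p) = p :=
  e.symm_apply_mk_proj (e.mem_source.2 hp)

variable (ES EP) in
/-- The horizontal lift of tangent vectors at `pr p` to `p` for the flat connection defined by the
trivialisation `e`. -/
noncomputable def flatLift (e : Trivialization G pr) (p : P) : ES →L[ℝ] EP :=
  mfderiv 𝓘(ℝ, ES) 𝓘(ℝ, EP) (flatSection e p) (pr p)

theorem IsSmoothTrivialization.hasMFDerivAt_symm {e : Trivialization G pr}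
    (he : IsSmoothTrivialization EG ES EP e) {x : S × G} (hx : x ∈ e.target) :
    HasMFDerivAt (𝓘(ℝ, ES).prod 𝓘(ℝ, EG)) 𝓘(ℝ, EP) e.toOpenPartialHomeomorph.symm x
      (mfderivWithin (𝓘(ℝ, ES).prod 𝓘(ℝ, EG)) 𝓘(ℝ, EP) e.toOpenPartialHomeomorph.symm
        e.target x) := by
  have h := ((he.symm_smooth.mdifferentiableOn (by simp)) x hx).hasMFDerivWithinAt
  exact h.hasMFDerivAt (e.open_target.mem_nhds hx)

theorem IsSmoothTrivialization.hasMFDerivAt_flatSection_aux {e : Trivialization G pr}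
    (he : IsSmoothTrivialization EG ES EP e) {p : P} (hp : pr p ∈ e.baseSet) :
    HasMFDerivAt 𝓘(ℝ, ES) 𝓘(ℝ, EP) (flatSection e p) (pr p)
      ((mfderivWithin (𝓘(ℝ, ES).prod 𝓘(ℝ, EG)) 𝓘(ℝ, EP) e.toOpenPartialHomeomorph.symm
        e.target (pr p, (e p).2) : ES × EG →L[ℝ] EP).comp
        ((ContinuousLinearMap.id ℝ ES).prod (0 : ES →L[ℝ] EG))) := by
  have hx : (pr p, (e p).2) ∈ e.target := e.mem_target.2 hp
  have h₁ : HasMFDerivAt 𝓘(ℝ, ES) (𝓘(ℝ, ES).prod 𝓘(ℝ, EG)) (fun c : S => (c, (e p).2)) (pr p)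
      ((ContinuousLinearMap.id ℝ ES).prod (0 : ES →L[ℝ] EG)) :=
    (hasMFDerivAt_id (I := 𝓘(ℝ, ES)) (pr p)).prodMk
      (hasMFDerivAt_const (I := 𝓘(ℝ, ES)) (I' := 𝓘(ℝ, EG)) (e p).2 (pr p))
  exact HasMFDerivAt.comp (pr p) (he.hasMFDerivAt_symm hx) h₁

theorem IsSmoothTrivialization.hasMFDerivAt_flatSection {e : Trivialization G pr}
    (he : IsSmoothTrivialization EG ES EP e) {p : P} (hp : pr p ∈ e.baseSet) :
    HasMFDerivAt 𝓘(ℝ, ES) 𝓘(ℝ, EP) (flatSection e p) (pr p) (flatLift ES EP e p) :=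
  (he.hasMFDerivAt_flatSection_aux hp).mdifferentiableAt.hasMFDerivAt

theorem IsSmoothTrivialization.flatLift_apply {e : Trivialization G pr}
    (he : IsSmoothTrivialization EG ES EP e) {p : P} (hp : pr p ∈ e.baseSet) (v : ES) :
    flatLift ES EP e p v =
      (mfderivWithin (𝓘(ℝ, ES).prod 𝓘(ℝ, EG)) 𝓘(ℝ, EP) e.toOpenPartialHomeomorph.symm
        e.target (pr p, (e p).2) : ES × EG →L[ℝ] EP) (v, 0) := by
  have h := hasMFDerivAt_unique (he.hasMFDerivAt_flatSection hp)
    (he.hasMFDerivAt_flatSection_aux hp)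
  exact DFunLike.congr_fun (F := ES →L[ℝ] EP) h v

theorem IsSmoothTrivialization.contMDiffAt_flatLift [IsManifold 𝓘(ℝ, ES) ∞ S]
    [IsManifold 𝓘(ℝ, EG) ∞ G] [IsManifold 𝓘(ℝ, EP) ∞ P] {e : Trivialization G pr}
    (he : IsSmoothTrivialization EG ES EP e) (hπ : ContMDiff 𝓘(ℝ, EP) 𝓘(ℝ, ES) ∞ pr)
    {p : P} (hp : pr p ∈ e.baseSet) {Z : ∀ c : S, TangentSpace 𝓘(ℝ, ES) c}
    (hZ : ContMDiffAt 𝓘(ℝ, ES) 𝓘(ℝ, ES).tangent ∞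
      (fun c => (⟨c, Z c⟩ : TangentBundle 𝓘(ℝ, ES) S)) (pr p)) :
    ContMDiffAt 𝓘(ℝ, EP) 𝓘(ℝ, EP).tangent ∞
      (fun q => (⟨q, flatLift ES EP e q (Z (pr q))⟩ : TangentBundle 𝓘(ℝ, EP) P)) p := by
  have hsrc : e.source ∈ 𝓝 p := e.open_source.mem_nhds (e.mem_source.2 hp)
  have hT := he.symm_smooth.contMDiffOn_tangentMapWithin (m := ∞) (by simp)
    e.open_target.uniqueMDiffOn
  have h₁ : ContMDiffAt 𝓘(ℝ, EP) 𝓘(ℝ, ES).tangent ∞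
      (fun q => (⟨pr q, Z (pr q)⟩ : TangentBundle 𝓘(ℝ, ES) S)) p :=
    ContMDiffAt.comp p hZ hπ.contMDiffAt
  have h₂ : ContMDiffAt 𝓘(ℝ, EP) 𝓘(ℝ, EG).tangent ∞
      (fun q => (⟨(e q).2, 0⟩ : TangentBundle 𝓘(ℝ, EG) G)) p :=
    ContMDiffAt.comp p (contMDiff_zeroSection ℝ (TangentSpace 𝓘(ℝ, EG) (M := G))).contMDiffAt
      (contMDiffAt_snd.comp p (he.smooth.contMDiffAt hsrc))
  have h₃ : ContMDiffAt 𝓘(ℝ, EP) (𝓘(ℝ, ES).prod 𝓘(ℝ, EG)).tangent ∞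
      (fun q => (⟨(pr q, (e q).2), (Z (pr q), 0)⟩ :
        TangentBundle (𝓘(ℝ, ES).prod 𝓘(ℝ, EG)) (S × G))) p :=
    ContMDiffAt.comp p (contMDiff_equivTangentBundleProd_symm (I := 𝓘(ℝ, ES)) (M := S)
      (I' := 𝓘(ℝ, EG)) (M' := G) (n := ∞)).contMDiffAt (h₁.prodMk h₂)
  have hopen : IsOpen (TotalSpace.proj ⁻¹' e.target :
      Set (TangentBundle (𝓘(ℝ, ES).prod 𝓘(ℝ, EG)) (S × G))) :=
    e.open_target.preimage (FiberBundle.continuous_proj _ _)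
  have h₄ := ContMDiffAt.comp p (hT.contMDiffAt (hopen.mem_nhds
    (x := ⟨(pr p, (e p).2), (Z (pr p), 0)⟩) (e.mem_target.2 hp))) h₃
  refine h₄.congr_of_eventuallyEq ?_
  filter_upwards [hsrc] with q hq
  have hq' : pr q ∈ e.baseSet := e.mem_source.1 hq
  exact TotalSpace.ext (flatSection_self e hq').symm (heq_of_eq (he.flatLift_apply hq' _))

theorem IsSmoothTrivialization.mfderiv_proj_flatLift {e : Trivialization G pr}
    (he : IsSmoothTrivialization EG ES EP e) {p : P} (hp : pr p ∈ e.baseSet)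
    (hπ : MDifferentiableAt 𝓘(ℝ, EP) 𝓘(ℝ, ES) pr p) (v : ES) :
    (mfderiv 𝓘(ℝ, EP) 𝓘(ℝ, ES) pr p : EP →L[ℝ] ES) (flatLift ES EP e p v) = v := by
  have h₁ : HasMFDerivAt 𝓘(ℝ, EP) 𝓘(ℝ, ES) pr (flatSection e p (pr p))
      (mfderiv 𝓘(ℝ, EP) 𝓘(ℝ, ES) pr p) := by
    rw [flatSection_self e hp]; exact hπ.hasMFDerivAt
  have h₂ := HasMFDerivAt.comp (pr p) h₁ (he.hasMFDerivAt_flatSection hp)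
  have h₃ : HasMFDerivAt 𝓘(ℝ, ES) 𝓘(ℝ, ES) (pr ∘ flatSection e p) (pr p)
      (ContinuousLinearMap.id ℝ ES) := by
    refine (hasMFDerivAt_id (I := 𝓘(ℝ, ES)) (pr p)).congr_of_eventuallyEq ?_
    filter_upwards [e.open_baseSet.mem_nhds hp] with c hc
    exact proj_flatSection e p hc
  exact DFunLike.congr_fun (F := ES →L[ℝ] ES) (hasMFDerivAt_unique h₂ h₃) v

namespace LieGroupoid.IsAdapted

variable {𝒢 : LieGroupoid EM EG M G} {μ : P → M} {act : P → G → P} {e : Trivialization G pr}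

theorem moment_eq (he : 𝒢.IsAdapted ES EP μ act e) {p : P} (hp : pr p ∈ e.baseSet) :
    μ p = 𝒢.s (e p).2 := by
  have h := he.moment_symm (pr p) hp (e p).2
  rwa [e.symm_apply_mk_proj (e.mem_source.2 hp)] at h

theorem moment_flatSection (he : 𝒢.IsAdapted ES EP μ act e) {p : P} (hp : pr p ∈ e.baseSet)
    {c : S} (hc : c ∈ e.baseSet) : μ (flatSection e p c) = μ p :=
  (he.moment_symm c hc _).trans (he.moment_eq hp).symm

theorem act_eq (he : 𝒢.IsAdapted ES EP μ act e) {p : P} (hp : pr p ∈ e.baseSet) {h : G}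
    (hh : μ p = 𝒢.t h) :
    act p h = e.toOpenPartialHomeomorph.symm (pr p, 𝒢.mul (e p).2 h) := by
  have := he.act_symm (pr p) hp (e p).2 h ((he.moment_eq hp).symm.trans hh)
  rwa [e.symm_apply_mk_proj (e.mem_source.2 hp)] at this

theorem proj_act (he : 𝒢.IsAdapted ES EP μ act e) {p : P} (hp : pr p ∈ e.baseSet) {h : G}
    (hh : μ p = 𝒢.t h) : pr (act p h) = pr p := by
  rw [he.act_eq hp hh, e.proj_symm_apply' hp]

theorem act_flatSection (he : 𝒢.IsAdapted ES EP μ act e) {p : P} (hp : pr p ∈ e.baseSet) {h : G}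
    (hh : μ p = 𝒢.t h) {c : S} (hc : c ∈ e.baseSet) :
    act (flatSection e p c) h = flatSection e (act p h) c := by
  rw [flatSection, he.act_symm c hc _ h ((he.moment_eq hp).symm.trans hh), flatSection,
    he.act_eq hp hh, e.apply_symm_apply' hp]

theorem mdifferentiableAt_moment (he : 𝒢.IsAdapted ES EP μ act e) {p : P}
    (hp : pr p ∈ e.baseSet) : MDifferentiableAt 𝓘(ℝ, EP) 𝓘(ℝ, EM) μ p := by
  have hsrc : e.source ∈ 𝓝 p := e.open_source.mem_nhds (e.mem_source.2 hp)
  have h₁ : ContMDiffAt 𝓘(ℝ, EP) 𝓘(ℝ, EM) ∞ (fun q => 𝒢.s (e q).2) p :=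
    ContMDiffAt.comp p 𝒢.s_submersion.contMDiff.contMDiffAt
      (contMDiffAt_snd.comp p (he.smooth.smooth.contMDiffAt hsrc))
  refine (h₁.congr_of_eventuallyEq ?_).mdifferentiableAt (by simp)
  filter_upwards [hsrc] with q hq using he.moment_eq (e.mem_source.1 hq)

theorem mdifferentiableWithinAt_act (he : 𝒢.IsAdapted ES EP μ act e) {p : P}
    (hp : pr p ∈ e.baseSet) (hπ : ContMDiff 𝓘(ℝ, EP) 𝓘(ℝ, ES) ∞ pr) {h : G} (hh : μ p = 𝒢.t h) :
    MDifferentiableWithinAt 𝓘(ℝ, EP) 𝓘(ℝ, EP) (fun q => act q h) (μ ⁻¹' {𝒢.t h}) p := by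
  have hsrc : e.source ∈ 𝓝 p := e.open_source.mem_nhds (e.mem_source.2 hp)
  have h₁ : ContMDiffWithinAt 𝓘(ℝ, EP) (𝓘(ℝ, EG).prod 𝓘(ℝ, EG)) ∞ (fun q => ((e q).2, h))
      (μ ⁻¹' {𝒢.t h} ∩ e.source) p :=
    ((contMDiffAt_snd.comp p (he.smooth.smooth.contMDiffAt hsrc)).prodMk
      contMDiffAt_const).contMDiffWithinAt
  have h₂ : ContMDiffWithinAt 𝓘(ℝ, EP) 𝓘(ℝ, EG) ∞ (fun q => 𝒢.mul (e q).2 h)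
      (μ ⁻¹' {𝒢.t h} ∩ e.source) p := by
    refine ContMDiffWithinAt.comp p (𝒢.mul_smooth ((e p).2, h) ?_) h₁ ?_
    · exact (he.moment_eq hp).symm.trans hh
    · rintro q ⟨hq, hqs⟩
      exact (he.moment_eq (e.mem_source.1 hqs)).symm.trans hq
  have h₃ : ContMDiffWithinAt 𝓘(ℝ, EP) 𝓘(ℝ, EP) ∞
      (fun q => e.toOpenPartialHomeomorph.symm (pr q, 𝒢.mul (e q).2 h))
      (μ ⁻¹' {𝒢.t h} ∩ e.source) p :=
    ContMDiffAt.comp_contMDiffWithinAt p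
      (he.smooth.symm_smooth.contMDiffAt (x := (pr p, 𝒢.mul (e p).2 h))
        (e.open_target.mem_nhds (e.mem_target.2 hp)))
      (hπ.contMDiffAt.contMDiffWithinAt.prodMk h₂)
  have h₄ := (h₃.congr (fun q hq => he.act_eq (e.mem_source.1 hq.2) hq.1)
    (he.act_eq hp hh)).mdifferentiableWithinAt (by simp)
  exact (mdifferentiableWithinAt_inter hsrc).1 h₄

theorem mfderiv_moment_flatLift (he : 𝒢.IsAdapted ES EP μ act e) {p : P} (hp : pr p ∈ e.baseSet)
    (v : ES) : (mfderiv 𝓘(ℝ, EP) 𝓘(ℝ, EM) μ p : EP →L[ℝ] EM) (flatLift ES EP e p v) = 0 := by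
  have h₁ : HasMFDerivAt 𝓘(ℝ, EP) 𝓘(ℝ, EM) μ (flatSection e p (pr p))
      (mfderiv 𝓘(ℝ, EP) 𝓘(ℝ, EM) μ p) := by
    rw [flatSection_self e hp]; exact (he.mdifferentiableAt_moment hp).hasMFDerivAt
  have h₂ := HasMFDerivAt.comp (pr p) h₁ (he.smooth.hasMFDerivAt_flatSection hp)
  have h₃ : HasMFDerivAt 𝓘(ℝ, ES) 𝓘(ℝ, EM) (μ ∘ flatSection e p) (pr p) (0 : ES →L[ℝ] EM) := by
    refine (hasMFDerivAt_const (I := 𝓘(ℝ, ES)) (I' := 𝓘(ℝ, EM)) (μ p) (pr p)).congr_of_eventuallyEq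
      ?_
    filter_upwards [e.open_baseSet.mem_nhds hp] with c hc
    exact he.moment_flatSection hp hc
  exact DFunLike.congr_fun (F := ES →L[ℝ] EM) (hasMFDerivAt_unique h₂ h₃) v

theorem map_flatLift (he : 𝒢.IsAdapted ES EP μ act e) {p : P} (hp : pr p ∈ e.baseSet)
    {h : G} (hh : μ p = 𝒢.t h) {L : EP →L[ℝ] EP}
    (hL : HasMFDerivWithinAt 𝓘(ℝ, EP) 𝓘(ℝ, EP) (fun q => act q h) (μ ⁻¹' {𝒢.t h}) p L) (v : ES) :
    L (flatLift ES EP e p v) = flatLift ES EP e (act p h) v := by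
  have hπ := he.proj_act hp hh
  have hmem := e.open_baseSet.mem_nhds hp
  have h₁ : HasMFDerivWithinAt 𝓘(ℝ, EP) 𝓘(ℝ, EP) (fun q => act q h) (μ ⁻¹' {𝒢.t h})
      (flatSection e p (pr p)) L := by
    rw [flatSection_self e hp]; exact hL
  have h₂ : HasMFDerivAt 𝓘(ℝ, ES) 𝓘(ℝ, EP) ((fun q => act q h) ∘ flatSection e p) (pr p)
      (L.comp (flatLift ES EP e p)) :=
    (HasMFDerivWithinAt.comp (pr p) h₁ (s := e.baseSet)
      (he.smooth.hasMFDerivAt_flatSection hp).hasMFDerivWithinAt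
      (fun c hc => (he.moment_flatSection hp hc).trans hh)).hasMFDerivAt hmem
  have h₃ : HasMFDerivAt 𝓘(ℝ, ES) 𝓘(ℝ, EP) (flatSection e (act p h)) (pr p)
      (flatLift ES EP e (act p h)) := by
    have := he.smooth.hasMFDerivAt_flatSection (p := act p h) (by rwa [hπ])
    rwa [hπ] at this
  have h₄ := h₃.congr_of_eventuallyEq (f₁ := (fun q => act q h) ∘ flatSection e p) (by
    filter_upwards [hmem] with c hc using he.act_flatSection hp hh hc)
  exact DFunLike.congr_fun (F := ES →L[ℝ] EP) (hasMFDerivAt_unique h₂ h₄) v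

end LieGroupoid.IsAdapted

variable (EP) in
/-- The horizontal lift at `p` for the average of the flat connections defined by the
trivialisations `e i`, with weights from a partition of unity of the base. -/
noncomputable def averageLift {ι : Type*}
    (ρ : SmoothPartitionOfUnity ι 𝓘(ℝ, ES) S) (e : ι → Trivialization G pr) (p : P) :
    ES →L[ℝ] EP :=
  ∑ i ∈ ρ.finsupport (pr p), ρ i (pr p) • flatLift ES EP (e i) p

section Average

variable {ι : Type*} {ρ : SmoothPartitionOfUnity ι 𝓘(ℝ, ES) S}
  {e : ι → Trivialization G pr}

theorem averageLift_apply (p : P) (v : ES) :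
    averageLift EP ρ e p v = ∑ i ∈ ρ.finsupport (pr p), ρ i (pr p) • flatLift ES EP (e i) p v := by
  simp [averageLift]

theorem averageLift_apply_of_subset {p : P} {J : Finset ι} (hJ : ρ.finsupport (pr p) ⊆ J) (v : ES) :
    averageLift EP ρ e p v = ∑ i ∈ J, ρ i (pr p) • flatLift ES EP (e i) p v := by
  rw [averageLift_apply]
  refine Finset.sum_subset hJ fun i _ hi => ?_
  have : ρ i (pr p) = 0 := by simpa [ρ.mem_finsupport] using hi
  rw [this, zero_smul]

theorem map_averageLift_of_forall_eq {F : Type*} [NormedAddCommGroup F] [NormedSpace ℝ F]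
    {D : EP →L[ℝ] F} {p : P} {v : ES} {w : F}
    (h : ∀ i ∈ ρ.finsupport (pr p), D (flatLift ES EP (e i) p v) = w) :
    D (averageLift EP ρ e p v) = w := by
  rw [averageLift_apply, map_sum]
  calc _ = ∑ i ∈ ρ.finsupport (pr p), ρ i (pr p) • w :=
        Finset.sum_congr rfl fun i hi => by rw [map_smul, h i hi]
    _ = w := by rw [← Finset.sum_smul, ρ.sum_finsupport _ (mem_univ (pr p)), one_smul]

theorem mem_baseSet_of_mem_fintsupport (hρ : ρ.IsSubordinate fun i => (e i).baseSet) {c : S} {i : ι}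
    (hi : i ∈ ρ.fintsupport c) : c ∈ (e i).baseSet :=
  hρ i ((ρ.mem_fintsupport_iff c i).1 hi)

theorem mem_baseSet_of_mem_finsupport (hρ : ρ.IsSubordinate fun i => (e i).baseSet) {c : S} {i : ι}
    (hi : i ∈ ρ.finsupport c) : c ∈ (e i).baseSet :=
  mem_baseSet_of_mem_fintsupport hρ (ρ.finsupport_subset_fintsupport c hi)

theorem contMDiffAt_averageLift [IsManifold 𝓘(ℝ, ES) ∞ S] [IsManifold 𝓘(ℝ, EG) ∞ G]
    [IsManifold 𝓘(ℝ, EP) ∞ P] (hρ : ρ.IsSubordinate fun i => (e i).baseSet)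
    (he : ∀ i, IsSmoothTrivialization EG ES EP (e i)) (hπ : ContMDiff 𝓘(ℝ, EP) 𝓘(ℝ, ES) ∞ pr)
    {p : P} {Z : ∀ c : S, TangentSpace 𝓘(ℝ, ES) c}
    (hZ : ContMDiffAt 𝓘(ℝ, ES) 𝓘(ℝ, ES).tangent ∞
      (fun c => (⟨c, Z c⟩ : TangentBundle 𝓘(ℝ, ES) S)) (pr p)) :
    ContMDiffAt 𝓘(ℝ, EP) 𝓘(ℝ, EP).tangent ∞
      (fun q => (⟨q, averageLift EP ρ e q (Z (pr q))⟩ : TangentBundle 𝓘(ℝ, EP) P)) p := by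
  have h₁ : ContMDiffAt 𝓘(ℝ, EP) 𝓘(ℝ, EP).tangent ∞
      (fun q => (⟨q, ∑ i ∈ ρ.fintsupport (pr p), ρ i (pr q) •
        (flatLift ES EP (e i) q (Z (pr q)) : TangentSpace 𝓘(ℝ, EP) q)⟩ :
        TangentBundle 𝓘(ℝ, EP) P)) p := by
    refine ContMDiffAt.sum_section fun i hi => ?_
    exact ContMDiffAt.smul_section ((ρ i).contMDiff.contMDiffAt.comp p hπ.contMDiffAt)
      ((he i).contMDiffAt_flatLift hπ (mem_baseSet_of_mem_fintsupport hρ hi) hZ)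
  refine h₁.congr_of_eventuallyEq ?_
  filter_upwards [hπ.continuous.continuousAt.eventually (ρ.eventually_finsupport_subset (pr p))]
    with q hq
  have h := averageLift_apply_of_subset (EP := EP) (e := e) hq (Z (pr q))
  exact TotalSpace.ext rfl (heq_of_eq h)

theorem mfderiv_proj_averageLift (hρ : ρ.IsSubordinate fun i => (e i).baseSet)
    (he : ∀ i, IsSmoothTrivialization EG ES EP (e i)) {p : P}
    (hπ : MDifferentiableAt 𝓘(ℝ, EP) 𝓘(ℝ, ES) pr p) (v : ES) :
    (mfderiv 𝓘(ℝ, EP) 𝓘(ℝ, ES) pr p : EP →L[ℝ] ES) (averageLift EP ρ e p v) = v := by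
  exact map_averageLift_of_forall_eq (EP := EP) (F := ES) fun i hi =>
    (he i).mfderiv_proj_flatLift (mem_baseSet_of_mem_finsupport hρ hi) hπ v

variable {𝒢 : LieGroupoid EM EG M G} {μ : P → M} {act : P → G → P}

theorem mfderiv_moment_averageLift (hρ : ρ.IsSubordinate fun i => (e i).baseSet)
    (he : ∀ i, 𝒢.IsAdapted ES EP μ act (e i)) (p : P) (v : ES) :
    (mfderiv 𝓘(ℝ, EP) 𝓘(ℝ, EM) μ p : EP →L[ℝ] EM) (averageLift EP ρ e p v) = 0 := by
  exact map_averageLift_of_forall_eq (EP := EP) (F := EM) fun i hi =>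
    (he i).mfderiv_moment_flatLift (mem_baseSet_of_mem_finsupport hρ hi) v

theorem map_averageLift (hρ : ρ.IsSubordinate fun i => (e i).baseSet)
    (he : ∀ i, 𝒢.IsAdapted ES EP μ act (e i)) {p : P} {h : G} (hh : μ p = 𝒢.t h)
    (hπ : pr (act p h) = pr p) {L : EP →L[ℝ] EP}
    (hL : HasMFDerivWithinAt 𝓘(ℝ, EP) 𝓘(ℝ, EP) (fun q => act q h) (μ ⁻¹' {𝒢.t h}) p L) (v : ES) :
    L (averageLift EP ρ e p v) = averageLift EP ρ e (act p h) v := by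
  rw [averageLift_apply, averageLift_apply, map_sum, hπ]
  refine Finset.sum_congr rfl fun i hi => ?_
  rw [map_smul, (he i).map_flatLift (mem_baseSet_of_mem_finsupport hρ hi) hh hL]

end Average

theorem LinearMap.isCompl_ker_range_of_leftInverse {R V W : Type*} [Ring R] [AddCommGroup V]
    [AddCommGroup W] [Module R V] [Module R W] {f : V →ₗ[R] W} {g : W →ₗ[R] V}
    (h : ∀ w, f (g w) = w) : IsCompl (LinearMap.ker f) (LinearMap.range g) := by
  refine ⟨Submodule.disjoint_def.2 ?_, codisjoint_iff.2 (eq_top_iff.2 fun x _ => ?_)⟩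
  · rintro _ hx ⟨w, rfl⟩
    rw [LinearMap.mem_ker, h] at hx
    rw [hx, map_zero]
  · exact Submodule.mem_sup.2 ⟨x - g (f x), by simp [h], g (f x), ⟨_, rfl⟩, by simp⟩

theorem LinearMap.span_range_apply_of_span_eq_top {ι R V W : Type*} [Ring R] [AddCommGroup V]
    [AddCommGroup W] [Module R V] [Module R W] (f : V →ₗ[R] W) {b : ι → V}
    (hb : Submodule.span R (Set.range b) = ⊤) :
    Submodule.span R (Set.range fun i => f (b i)) = LinearMap.range f := by
  rw [← Submodule.map_top, ← hb, Submodule.map_span, ← Set.range_comp]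
  rfl

/-- The ranges of smoothly varying injective linear maps from the tangent spaces of the base form a
smooth distribution. -/
theorem isSmoothDistribution_range [FiniteDimensional ℝ ES] [IsManifold 𝓘(ℝ, ES) ∞ S]
    [IsManifold 𝓘(ℝ, EP) ∞ P] (hπ : Continuous pr) {A : P → ES →L[ℝ] EP}
    (hinj : ∀ p, Function.Injective (A p))
    (hA : ∀ (p : P) (Z : ∀ c : S, TangentSpace 𝓘(ℝ, ES) c),
      ContMDiffAt 𝓘(ℝ, ES) 𝓘(ℝ, ES).tangent ∞
        (fun c => (⟨c, Z c⟩ : TangentBundle 𝓘(ℝ, ES) S)) (pr p) →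
      ContMDiffAt 𝓘(ℝ, EP) 𝓘(ℝ, EP).tangent ∞
        (fun q => (⟨q, A q (Z (pr q))⟩ : TangentBundle 𝓘(ℝ, EP) P)) p) :
    IsSmoothDistribution (EP := EP) (P := P) fun p => LinearMap.range (A p).toLinearMap := by
  intro p₀
  let t := trivializationAt ES (TangentSpace 𝓘(ℝ, ES) (M := S)) (pr p₀)
  let b := Module.finBasis ℝ ES
  have ht := t.isLocalFrameOn_localFrame_baseSet 𝓘(ℝ, ES) ∞ b
  refine ⟨pr ⁻¹' t.baseSet, (t.open_baseSet.preimage hπ).mem_nhds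
    (FiberBundle.mem_baseSet_trivializationAt' (F := ES)
      (E := TangentSpace 𝓘(ℝ, ES) (M := S)) (pr p₀)), Module.finrank ℝ ES,
    fun i p => A p (t.localFrame b i (pr p)), fun i p hp => ?_, fun p hp => ⟨?_, ?_⟩⟩
  · exact (hA p (t.localFrame b i)
      (contMDiffAt_localFrame_of_mem ∞ t b i hp)).contMDiffWithinAt
  · exact LinearIndependent.map' (ht.linearIndependent hp) (A p).toLinearMap
      (LinearMap.ker_eq_bot.2 (hinj p))
  · exact LinearMap.span_range_apply_of_span_eq_top (A p).toLinearMap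
      (top_le_iff.1 (ht.generating hp))

/-- A submersion that has adapted trivialisations around all points of the base has a compatible
connection. -/
theorem exists_isCompatibleConnection [FiniteDimensional ℝ ES] [IsManifold 𝓘(ℝ, ES) ∞ S]
    [T2Space S] [SecondCountableTopology S] [IsManifold 𝓘(ℝ, EG) ∞ G] [IsManifold 𝓘(ℝ, EP) ∞ P]
    {𝒢 : LieGroupoid EM EG M G} {μ : P → M} {act : P → G → P}
    (hπ : ContMDiff 𝓘(ℝ, EP) 𝓘(ℝ, ES) ∞ pr)
    (htriv : ∀ b : S, ∃ e : Trivialization G pr, b ∈ e.baseSet ∧ 𝒢.IsAdapted ES EP μ act e) :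
    ∃ H : ∀ p : P, Submodule ℝ (TangentSpace 𝓘(ℝ, EP) p),
      IsCompatibleConnection (ES := ES) 𝒢 pr μ act H := by
  choose e hmem he using htriv
  have : LocallyCompactSpace S := ChartedSpace.locallyCompactSpace ES S
  obtain ⟨ρ, hρ⟩ := SmoothPartitionOfUnity.exists_isSubordinate 𝓘(ℝ, ES) (isClosed_univ (X := S))
    (fun b => (e b).baseSet) (fun b => (e b).open_baseSet)
    (fun b _ => mem_iUnion.2 ⟨b, hmem b⟩)
  have hsplit : ∀ p v, (mfderiv 𝓘(ℝ, EP) 𝓘(ℝ, ES) pr p : EP →L[ℝ] ES) (averageLift EP ρ e p v) = v :=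
    fun p v => mfderiv_proj_averageLift hρ (fun b => (he b).smooth)
      (hπ.mdifferentiableAt (by simp)) v
  refine ⟨fun p => LinearMap.range (averageLift EP ρ e p).toLinearMap, ?_, ?_, ?_, ?_⟩
  · exact isSmoothDistribution_range hπ.continuous
      (fun p => Function.LeftInverse.injective (hsplit p))
      (fun p Z hZ => contMDiffAt_averageLift hρ (fun b => (he b).smooth) hπ hZ)
  · exact fun p => LinearMap.isCompl_ker_range_of_leftInverse (hsplit p)
  · rintro p _ ⟨v, rfl⟩
    exact mfderiv_moment_averageLift hρ he p v
  · intro g p hg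
    have hL := ((he (pr p)).mdifferentiableWithinAt_act (hmem _) hπ hg).hasMFDerivWithinAt
    refine ⟨_, hL, ?_⟩
    have h := map_averageLift hρ he hg ((he (pr p)).proj_act (hmem _) hg) hL
    ext w
    constructor
    · rintro ⟨_, ⟨v, rfl⟩, rfl⟩
      exact ⟨v, (h v).symm⟩
    · rintro ⟨v, rfl⟩
      exact ⟨_, ⟨v, rfl⟩, h v⟩

end AdaptedTrivializations

theorem mainTheorem5
    {EM EG ES EP : Type*}
    [NormedAddCommGroup EM] [NormedSpace ℝ EM] [FiniteDimensional ℝ EM]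
    [NormedAddCommGroup EG] [NormedSpace ℝ EG] [FiniteDimensional ℝ EG]
    [NormedAddCommGroup ES] [NormedSpace ℝ ES] [FiniteDimensional ℝ ES]
    [NormedAddCommGroup EP] [NormedSpace ℝ EP] [FiniteDimensional ℝ EP]
    {M G S P : Type*}
    [TopologicalSpace M] [ChartedSpace EM M] [IsManifold 𝓘(ℝ, EM) ∞ M]
    [TopologicalSpace G] [ChartedSpace EG G] [IsManifold 𝓘(ℝ, EG) ∞ G]
    [TopologicalSpace S] [ChartedSpace ES S] [IsManifold 𝓘(ℝ, ES) ∞ S]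
    [T2Space S] [SecondCountableTopology S]
    [TopologicalSpace P] [ChartedSpace EP P] [IsManifold 𝓘(ℝ, EP) ∞ P]
    (𝒢 : LieGroupoid EM EG M G) :
    (∀ X : PrincipaloidGBundle ES EP S P 𝒢,
      ∃ H : ∀ p : P, Submodule ℝ (TangentSpace 𝓘(ℝ, EP) p),
        IsCompatibleConnection (ES := ES) 𝒢 X.π X.μ X.act H) ∧
    (∀ X : PrincipaloidBundle ES EP S P 𝒢,
      ∃ H : ∀ p : P, Submodule ℝ (TangentSpace 𝓘(ℝ, EP) p),
        IsCompatibleConnection (ES := ES) 𝒢 X.π X.μ X.act H) := by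
  refine ⟨fun X => exists_isCompatibleConnection X.π_submersion.contMDiff fun b => ?_,
    fun X => exists_isCompatibleConnection X.π_submersion.contMDiff fun b => ?_⟩
  · obtain ⟨e, hb, he, h⟩ := X.exists_trivialization b
    exact ⟨e, hb, he, fun c hc g => (h c hc g).1, fun c hc g => (h c hc g).2⟩
  · obtain ⟨e, he, hb⟩ := X.atlas_cover b
    exact ⟨e, hb, X.atlas_smooth e he, fun c hc => X.μ_symm he hc, fun c hc => X.act_symm he hc⟩
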